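/- Conventions. A metric space $(X,d)$ is $N$-doubling ($N\in\mathbb N$) if every open ball can be covered by at most $N$ open balls of half the radius. It is $L$-linearly connected ($L\ge 1$) if for all $x,y\in X$ there is a compact connected set containing $x$ and $y$ of diameter at most $L\,d(x,y)$. An arc is the image of $[0,1]$ under an injective continuous map; for points $x,y$ of an arc $A$, $A[x,y]$ denotes the closed (possibly trivial) subarc of $A$ between them. An arc $A$ is an $\eta$-local $\lambda$-quasi-arc if $\operatorname{diam}(A[x,y])\le\lambda\, d(x,y)$ for all $x,y\in A$ with $d(x,y)\le\eta$. For arcs $A$ and $B$, each with its endpoints labelled first and last, $B$ $\varepsilon$-follows $A$ if there is a (not necessarily continuous) map $p:B\to A$, sending the first endpoint of $B$ to the first endpoint of $A$ and the last to the last, such that for all $x,y\in B$ the subarc $B[x,y]$ is contained in the $\varepsilon$-neighbourhood $\{z: d(z,A[p(x),p(y)])<\varepsilon\}$. Theorem 1.1 (Tukia). For every $L\ge 1$ and $N\in\mathbb N$ there are constants $\lambda=\lambda(L,N)\ge 1$ and $\alpha=\alpha(L,N)>0$ such that the following holds. Let $X$ be a complete metric space that is $L$-linearly connected and $N$-doubling.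 Then for every arc $A$ in $X$ with endpoints labelled first and last, and every $\varepsilon>0$, there is an arc $J$ in $X$ with the same first and the same last endpoint as $A$ that $\varepsilon$-follows $A$ and is an $\alpha\varepsilon$-local $\lambda$-quasi-arc. -/

import Mathlib

namespace QuasiArc

open Set

/-- `X` is `N`-doubling: every (open) ball is covered by at most `N` balls of half the radius. -/
def IsDoubling (X : Type*) [MetricSpace X] (N : ℕ) : Prop :=
  ∀ (x : X) (r : ℝ), 0 < r →
    ∃ S : Finset X, S.card ≤ N ∧ Metric.ball x r ⊆ ⋃ y ∈ S, Metric.ball y (r / 2)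

/-- `X` is `L`-linearly connected: any two points `x, y` lie in a compact connected set of
diameter at most `L * dist x y`. -/
def IsLinearlyConnected (X : Type*) [MetricSpace X] (L : ℝ) : Prop :=
  ∀ x y : X, ∃ J : Set X, IsCompact J ∧ IsConnected J ∧ x ∈ J ∧ y ∈ J ∧
    Metric.diam J ≤ L * dist x y

/-- An arc in `X`, given by an injective continuous parametrization over `[0, 1]`.
(In a Hausdorff space this is a homeomorphism onto its image.) -/
structure Arc (X : Type*) [TopologicalSpace X] where
  /-- the parametrization -/
  param : C(unitInterval, X)
  injective : Function.Injective param

namespace Arc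

variable {X : Type*}

/-- The underlying point set of the arc. -/
def carrier [TopologicalSpace X] (A : Arc X) : Set X := range A.param

/-- The first endpoint. -/
def source [TopologicalSpace X] (A : Arc X) : X := A.param 0

/-- The last endpoint. -/
def target [TopologicalSpace X] (A : Arc X) : X := A.param 1

/-- The closed, possibly trivial, subarc `A[x,y]` between two points `x, y` of `A`,
irrespective of their order along `A`. -/
def subarc [TopologicalSpace X] (A : Arc X) (x y : X) : Set X :=
  {z | ∃ s t : unitInterval, A.param s = x ∧ A.param t = y ∧ z ∈ A.param '' uIcc s t}

theorem subarc_param [TopologicalSpace X] (A : Arc X) (s t : unitInterval) :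
    A.subarc (A.param s) (A.param t) = A.param '' uIcc s t := by
  ext z
  constructor
  · rintro ⟨s', t', hs, ht, hz⟩
    rwa [A.injective hs, A.injective ht] at hz
  · intro hz
    exact ⟨s, t, rfl, rfl, hz⟩

/-- `A` is an `ε`-local `lam`-quasi-arc: `diam A[x,y] ≤ lam * dist x y` for all points `x, y` of
`A` at distance at most `ε`. -/
def IsLocalQuasiArc [MetricSpace X] (A : Arc X) (ε lam : ℝ) : Prop :=
  ∀ x ∈ A.carrier, ∀ y ∈ A.carrier, dist x y ≤ ε →
    Metric.diam (A.subarc x y) ≤ lam * dist x y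

/-- `B` `ε`-follows `A`: there is a (not necessarily continuous) map `p` from `B` to `A`, sending
the first and last endpoints of `B` to those of `A`, such that for all `x, y ∈ B` the subarc
`B[x,y]` lies in the `ε`-neighbourhood `{z | dist(z, A[p x, p y]) < ε}` of `A[p x, p y]`.
Only the values of `p` on `B` matter. -/
def Follows [MetricSpace X] (B A : Arc X) (ε : ℝ) : Prop :=
  ∃ p : X → X, MapsTo p B.carrier A.carrier ∧
    p B.source = A.source ∧ p B.target = A.target ∧
    ∀ x ∈ B.carrier, ∀ y ∈ B.carrier,
      B.subarc x y ⊆ Metric.thickening ε (A.subarc (p x) (p y))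

end Arc

end QuasiArc

namespace QuasiArc

open Set Metric Relation Filter Topology

/-! ### Covers by connected sets whose disjoint members are quantitatively apart -/

section Cover

variable {X : Type*} [MetricSpace X]

/-! At every scale `r` the space is covered by connected sets of size about `r`, any two of which
either meet or lie at distance at least `c * r` (`exists_isSeparatedCover`). In a chain where only
consecutive sets meet, non-consecutive ones are therefore quantitatively apart.

Loop erasure of a walk along `A` gives such a chain at scale `ρ = ε / (6 * C)`; parameters of `A`,
carried along as monotone labels, make it follow `A`. The same argument inside a chain at scale `ρ *
δ ^ n` gives a chain at scale `ρ * δ ^ (n + 1)` running through the coarser one in order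
(`IsSimpleChain.exists_refinement`). Eventually every coarse member carries two consecutive fine
ones, so the chains index nested subdivisions of `[0, 1]` with mesh tending to zero
(`exists_compatible_indices`), and their centres converge uniformly to a path `J`
(`IsSimpleChain.exists_limit_arc`).

If the level-`n` indices of `s` and `t` differ by at least two, then `J s` and `J t` are more than
`c / 2 * ρ * δ ^ n` apart, because the approximation errors live at the next scale; hence `J` is
injective. Conversely, points closer than this have equal or adjacent indices, so the subarc between
them has diameter at most a multiple of `ρ * δ ^ n`. Choosing `n` according to the distance gives
the quasi-arc bound. -/

theorem exists_maximal_separated (X : Type*) [MetricSpace X] {r : ℝ} (hr : 0 < r) :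
    ∃ P : Set X, P.Pairwise (fun x y => r ≤ dist x y) ∧ ∀ z, ∃ x ∈ P, dist z x < r := by
  obtain ⟨P, hP⟩ := zorn_subset {P : Set X | P.Pairwise (fun x y => r ≤ dist x y)} (by
    intro c hc hchain
    refine ⟨⋃₀ c, ?_, fun s hs => subset_sUnion_of_mem hs⟩
    exact (pairwise_sUnion hchain.directedOn).2 fun s hs => hc hs)
  refine ⟨P, hP.prop, fun z => ?_⟩
  by_contra! hz
  have hins : (insert z P).Pairwise (fun x y => r ≤ dist x y) :=
    hP.prop.insert fun y hy _ => ⟨hz y hy, by rw [dist_comm]; exact hz y hy⟩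
  have hzP : z ∈ P := hP.le_of_ge hins (subset_insert z P) (mem_insert z P)
  have := hz z hzP
  rw [dist_self] at this
  linarith

theorem IsDoubling.exists_cover_pow {N : ℕ} (hX : IsDoubling X N) (m : ℕ) (x : X) {r : ℝ}
    (hr : 0 < r) :
    ∃ S : Finset X, S.card ≤ N ^ m ∧ ball x r ⊆ ⋃ y ∈ S, ball y (r / 2 ^ m) := by
  classical
  induction m with
  | zero => exact ⟨{x}, by simp, by simp⟩
  | succ m ih =>
    obtain ⟨S, hS, hSc⟩ := ih
    choose T hT hTc using fun y => hX y (r / 2 ^ m) (by positivity)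
    refine ⟨S.biUnion T, ?_, ?_⟩
    · calc (S.biUnion T).card ≤ S.card * N := Finset.card_biUnion_le_card_mul _ _ _ fun y _ => hT y
        _ ≤ N ^ m * N := Nat.mul_le_mul_right _ hS
        _ = N ^ (m + 1) := (pow_succ _ _).symm
    · intro z hz
      obtain ⟨y, hy, hzy⟩ := mem_iUnion₂.1 (hSc hz)
      obtain ⟨w, hw, hzw⟩ := mem_iUnion₂.1 (hTc y hzy)
      refine mem_iUnion₂.2 ⟨w, Finset.mem_biUnion.2 ⟨y, hy, hw⟩, ?_⟩
      rwa [pow_succ, ← div_div]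

theorem IsDoubling.encard_le_of_separated {N : ℕ} (hX : IsDoubling X N) {m : ℕ} {x : X}
    {r R : ℝ} (hR : 0 < R) (hm : 2 * (R / 2 ^ m) ≤ r) {T : Set X} (hT : T ⊆ ball x R)
    (hsep : T.Pairwise (fun x y => r ≤ dist x y)) : T.encard ≤ (N ^ m : ℕ) := by
  obtain ⟨S, hS, hSc⟩ := hX.exists_cover_pow m x hR
  have key : ∀ z ∈ T, ∃ y ∈ S, z ∈ ball y (R / 2 ^ m) := fun z hz => by
    simpa using hSc (hT hz)
  choose! g hg hgb using key
  calc T.encard ≤ (S : Set X).encard := by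
        refine encard_le_encard_of_injOn (f := g) (fun z hz => hg z hz) fun z hz w hw h => ?_
        by_contra hne
        have h1 := hsep hz hw hne
        have h2 := mem_ball.1 (hgb z hz)
        have h3 := mem_ball'.1 (hgb w hw)
        rw [← h] at h3
        linarith [dist_triangle z (g z) w]
    _ = S.card := encard_coe_eq_coe_finsetCard S
    _ ≤ (N ^ m : ℕ) := by exact_mod_cast hS

/-- Greedy colouring along a well-order: each point takes the least colour not used by its earlier
neighbours, of which there are fewer than `M`. -/
theorem exists_coloring {α : Type*} (adj : α → α → Prop) (hsymm : ∀ x y, adj x y → adj y x)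
    (M : ℕ) (hM : ∀ x, {y | adj x y}.encard < M) :
    ∃ κ : α → ℕ, (∀ x, κ x < M) ∧ ∀ x y, adj x y → x ≠ y → κ x ≠ κ y := by
  have wf : WellFounded (WellOrderingRel (α := α)) := IsWellFounded.wf
  let κ : α → ℕ := wf.fix fun x ih => sInf {c | ∀ y (h : WellOrderingRel y x), adj x y → ih y h ≠ c}
  have hκ : ∀ x, κ x = sInf {c | ∀ y, WellOrderingRel y x → adj x y → κ y ≠ c} := fun x =>
    wf.fix_eq _ x
  have hex : ∀ x, ∃ c < M, ∀ y, WellOrderingRel y x → adj x y → κ y ≠ c := by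
    intro x
    by_contra! h
    have hsub : Iio M ⊆ κ '' {y | adj x y} := fun c hc => by
      obtain ⟨y, -, hy, rfl⟩ := h c hc
      exact ⟨y, hy, rfl⟩
    have h1 := (encard_le_encard hsub).trans (encard_image_le _ _)
    have h2 : (Iio M).encard = M := by
      rw [← Finset.coe_Iio, encard_coe_eq_coe_finsetCard, Nat.card_Iio]
    rw [h2] at h1
    exact absurd (hM x) (not_lt.2 h1)
  have hspec : ∀ x y, WellOrderingRel y x → adj x y → κ y ≠ κ x := by
    intro x
    obtain ⟨c, -, hc⟩ := hex x
    have := Nat.sInf_mem (s := {c | ∀ y, WellOrderingRel y x → adj x y → κ y ≠ c}) ⟨c, hc⟩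
    rwa [← hκ] at this
  refine ⟨κ, fun x => ?_, fun x y hxy hne => ?_⟩
  · obtain ⟨c, hcM, hc⟩ := hex x
    rw [hκ]
    exact lt_of_le_of_lt (Nat.sInf_le (m := c) (by exact hc)) hcM
  · rcases trichotomous_of WellOrderingRel x y with h | h | h
    · exact hspec y x h (hsymm x y hxy)
    · exact absurd h hne
    · exact (hspec x y h hxy).symm

theorem IsLinearlyConnected.exists_connecting {L : ℝ} (hX : IsLinearlyConnected X L) :
    ∃ J : X → X → Set X, ∀ x y, IsPreconnected (J x y) ∧ x ∈ J x y ∧ y ∈ J x y ∧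
      ∀ z ∈ J x y, dist z x ≤ L * dist x y := by
  choose J hc hconn hx hy hd using hX
  exact ⟨J, fun x y => ⟨(hconn x y).isPreconnected, hx x y, hy x y, fun z hz =>
    (dist_le_diam_of_mem (hc x y).isBounded hz (hx x y)).trans (hd x y)⟩⟩

/-- One joining step: sets indexed by the color class `a` absorb connections to all sets of the
color class `b` at distance less than `θ`. -/
theorem IsLinearlyConnected.exists_join {L : ℝ} (hL : 1 ≤ L) (hX : IsLinearlyConnected X L)
    {P : Set X} {κ : X → ℕ} {C r θ : ℝ} (hC : 1 ≤ C) (hr : 0 < r) (hθr : L * θ ≤ r) (hθ : 0 < θ)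
    (hκ : ∀ x ∈ P, ∀ y ∈ P, κ x = κ y → x ≠ y → 6 * C * r < dist x y)
    {V : X → Set X} (hV : ∀ x, IsPreconnected (V x)) (hx : ∀ x, x ∈ V x)
    (hVC : ∀ x, V x ⊆ closedBall x (C * r)) (a b : ℕ) :
    ∃ V' : X → Set X, (∀ x, IsPreconnected (V' x)) ∧ (∀ x, V x ⊆ V' x) ∧
      (∀ x, ∀ z ∈ V' x, ∃ v ∈ V x, dist z v ≤ L * θ) ∧
      ∀ x ∈ P, ∀ y ∈ P, κ x = a → κ y = b → Disjoint (V' x) (V' y) →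
        ∀ u ∈ V' x, ∀ v ∈ V' y, θ ≤ dist u v := by
  have hθr' : θ ≤ r := by nlinarith
  have hCr : r ≤ C * r := by nlinarith
  -- Within one colour class nothing need be added: centres more than `6 * C * r` apart leave sets
  -- of radius `C * r` at distance at least `θ`.
  by_cases hab : a = b
  · refine ⟨V, hV, fun _ => Subset.rfl, fun x z hz => ⟨z, hz, by simp; positivity⟩, ?_⟩
    intro x hxP y hyP hxa hyb hdis u hu v hv
    have hne : x ≠ y := by
      rintro rfl
      exact disjoint_left.1 hdis (hx x) (hx x)
    have h1 := hκ x hxP y hyP (by rw [hxa, hyb, hab]) hne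
    have h2 := mem_closedBall'.1 (hVC x hu)
    have h3 := mem_closedBall.1 (hVC y hv)
    linarith [dist_triangle4 x u v y]
  obtain ⟨J, hJ⟩ := hX.exists_connecting
  let V' : X → Set X := fun x => V x ∪ {z | κ x = a ∧ ∃ u ∈ V x, ∃ y ∈ P, κ y = b ∧ ∃ v ∈ V y,
    dist u v < θ ∧ z ∈ J u v}
  have hsub : ∀ x, V x ⊆ V' x := fun x => subset_union_left
  refine ⟨V', fun x => ?_, hsub, fun x z hz => ?_, ?_⟩
  · refine isPreconnected_of_forall x ?_
    rintro z (hz | ⟨hxa, u, hu, y, hy, hyb, v, hv, huv, hz⟩)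
    · exact ⟨V x, hsub x, hx x, hz, hV x⟩
    · refine ⟨V x ∪ J u v, union_subset (hsub x) fun w hw =>
        Or.inr ⟨hxa, u, hu, y, hy, hyb, v, hv, huv, hw⟩, Or.inl (hx x), Or.inr hz, ?_⟩
      exact IsPreconnected.union u hu (hJ u v).2.1 (hV x) (hJ u v).1
  · rcases hz with hz | ⟨hxa, u, hu, y, hy, hyb, v, hv, huv, hz⟩
    · exact ⟨z, hz, by simp; positivity⟩
    · exact ⟨u, hu, ((hJ u v).2.2.2 z hz).trans (by gcongr)⟩
  · intro x hxP y hyP hxa hyb hdis u hu v hv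
    have hvV : v ∈ V y := by
      rcases hv with hv | ⟨hya, -⟩
      · exact hv
      · exact absurd (hya.symm.trans hyb) hab
    by_contra! hlt
    rcases hu with hu | ⟨-, u₀, hu₀, y', hy', hy'b, v₀, hv₀, huv₀, huJ⟩
    · exact disjoint_left.1 hdis
        (Or.inr ⟨hxa, u, hu, y, hyP, hyb, v, hvV, hlt, (hJ u v).2.2.1⟩ : v ∈ V' x) hv
    · by_cases hyy : y' = y
      · subst hyy
        exact disjoint_left.1 hdis
          (Or.inr ⟨hxa, u₀, hu₀, y', hyP, hyb, v₀, hv₀, huv₀, (hJ u₀ v₀).2.2.1⟩ : v₀ ∈ V' x)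
          (hsub y' hv₀)
      -- Here `u` would be close to two different sets of colour `b`. The route `y', v₀, u₀, u, v,
      -- y` has length below `2 * C * r + 2 * θ + L * θ`, which contradicts the spacing of that
      -- colour.
      · have h1 := hκ y' hy' y hyP (by rw [hy'b, hyb]) hyy
        have h2 := mem_closedBall'.1 (hVC y' hv₀)
        have h3 := mem_closedBall.1 (hVC y hvV)
        have h4 := (hJ u₀ v₀).2.2.2 u huJ
        have h5 : L * dist u₀ v₀ ≤ L * θ := by gcongr
        have h6 := dist_triangle4 y' v₀ u₀ y
        have h7 := dist_triangle4 u₀ u v y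
        rw [dist_comm] at huv₀
        rw [dist_comm] at h4
        rw [dist_comm u₀ v₀] at h4 h5
        linarith

/-- A family of connected sets of size comparable to `r`, in which disjoint members are
quantitatively disjoint. -/
structure IsSeparatedCover (V : X → Set X) (C c r : ℝ) : Prop where
  isPreconnected : ∀ x, IsPreconnected (V x)
  mem_of_dist_le : ∀ x y, dist x y ≤ r → y ∈ V x
  subset_closedBall : ∀ x, V x ⊆ closedBall x (C * r)
  le_dist : ∀ x y, Disjoint (V x) (V y) → ∀ u ∈ V x, ∀ v ∈ V y, c * r ≤ dist u v

/-- The thresholds `θ = q ^ (m + 1) * r`, with `q = 1 / (8 * L)`, shrink fast enough for a gap won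
at one step to survive the later ones: each set grows by at most `L * θ`, so a gap of `3 * L * θ`
keeps at least `L * θ`. The total growth is bounded by a geometric series with sum `r`. -/
theorem IsLinearlyConnected.exists_iterate_join {L : ℝ} (hL : 1 ≤ L)
    (hX : IsLinearlyConnected X L) {P : Set X} {κ : X → ℕ} {r : ℝ} (hr : 0 < r)
    (hκ : ∀ x ∈ P, ∀ y ∈ P, κ x = κ y → x ≠ y → 6 * (2 * L + 1) * r < dist x y)
    (a b : ℕ → ℕ) (m : ℕ) :
    ∃ V : X → Set X, (∀ x, IsPreconnected (V x)) ∧ (∀ x y, dist x y ≤ 2 * r → y ∈ V x) ∧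
      (∀ x, V x ⊆ closedBall x ((2 * L + 1 - (1 / 2) ^ m) * r)) ∧
      ∀ i < m, ∀ x ∈ P, ∀ y ∈ P, κ x = a i → κ y = b i → Disjoint (V x) (V y) →
        ∀ u ∈ V x, ∀ v ∈ V y, 3 * L * (1 / (8 * L)) ^ (m + 1) * r ≤ dist u v := by
  have hL0 : 0 < L := by linarith
  induction m with
  | zero =>
    obtain ⟨J, hJ⟩ := hX.exists_connecting
    -- Radius `2 * r` rather than `r`: a point will later receive the set of a net point at distance
    -- less than `r`, which must still contain the `r`-ball about the point itself.
    refine ⟨fun x => ⋃ y ∈ closedBall x (2 * r), J x y, fun x => ?_, fun x y hxy => ?_,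
      fun x z hz => ?_, by simp⟩
    · refine isPreconnected_of_forall x fun z hz => ?_
      obtain ⟨y, hy, hz⟩ := mem_iUnion₂.1 hz
      exact ⟨J x y, subset_biUnion_of_mem (u := fun y => J x y) hy, (hJ x y).2.1, hz, (hJ x y).1⟩
    · exact mem_iUnion₂.2 ⟨y, mem_closedBall'.2 hxy, (hJ x y).2.2.1⟩
    · obtain ⟨y, hy, hz⟩ := mem_iUnion₂.1 hz
      have h1 := (hJ x y).2.2.2 z hz
      have h2 : L * dist x y ≤ L * (2 * r) := by
        gcongr
        exact mem_closedBall'.1 hy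
      rw [mem_closedBall]
      simp only [pow_zero]
      linarith
  | succ m ih =>
    obtain ⟨V, hV, hV2, hVC, hVs⟩ := ih
    have hq : (1 / (8 * L)) ≤ 1 / 8 := by
      apply one_div_le_one_div_of_le <;> linarith
    have hq0 : 0 < 1 / (8 * L) := by positivity
    have hLq : L * (1 / (8 * L)) = 1 / 8 := by field_simp
    set q := 1 / (8 * L) with hqdef
    have hqm : q ^ m ≤ (1 / 2) ^ m := pow_le_pow_left₀ hq0.le (by linarith) m
    have hqm0 : 0 < q ^ m := by positivity
    have hpm : ((1 : ℝ) / 2) ^ m ≤ 1 := pow_le_one₀ (by norm_num) (by norm_num)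
    have hpm0 : (0 : ℝ) < (1 / 2) ^ m := by positivity
    have hLθ : L * (q ^ (m + 1) * r) = 1 / 8 * q ^ m * r := by
      rw [pow_succ, ← hLq]; ring
    obtain ⟨V', hV', hsub, hnear, hsep⟩ := hX.exists_join hL (C := 2 * L + 1)
      (θ := q ^ (m + 1) * r) (by linarith) hr
      (by rw [hLθ]; nlinarith) (by positivity) hκ hV (fun x => hV2 x x (by simp; positivity))
      (fun x => (hVC x).trans (closedBall_subset_closedBall (by gcongr; linarith))) (a m) (b m)
    refine ⟨V', hV', fun x y hxy => hsub x (hV2 x y hxy), fun x z hz => ?_, ?_⟩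
    · obtain ⟨v, hv, hzv⟩ := hnear x z hz
      have h1 := mem_closedBall.1 (hVC x hv)
      rw [mem_closedBall]
      have : (2 * L + 1 - (1 / 2) ^ (m + 1)) * r =
        (2 * L + 1 - (1 / 2) ^ m) * r + 1 / 2 * ((1 / 2) ^ m * r) := by rw [pow_succ]; ring
      have h3 : q ^ m * r ≤ (1 / 2) ^ m * r := by gcongr
      have h4 : 0 < (1 / 2) ^ m * r := by positivity
      linarith [dist_triangle z v x]
    · intro i hi x hx y hy hxa hyb hdis u hu v hv
      have hT : 0 < q ^ (m + 1) * r := by positivity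
      have e1 : 3 * L * q ^ (m + 1 + 1) * r = 3 / 8 * (q ^ (m + 1) * r) := by
        calc 3 * L * q ^ (m + 1 + 1) * r = 3 * (L * q) * q ^ (m + 1) * r := by ring
          _ = 3 / 8 * (q ^ (m + 1) * r) := by rw [hLq]; ring
      rw [e1]
      rcases Nat.lt_succ_iff_lt_or_eq.1 hi with hi | rfl
      · obtain ⟨u₀, hu₀, huu⟩ := hnear x u hu
        obtain ⟨v₀, hv₀, hvv⟩ := hnear y v hv
        have h1 := hVs i hi x hx y hy hxa hyb (hdis.mono (hsub x) (hsub y)) u₀ hu₀ v₀ hv₀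
        have h2 : q ^ (m + 1) * r ≤ L * (q ^ (m + 1) * r) := le_mul_of_one_le_left hT.le hL
        have h3 : 3 * L * q ^ (m + 1) * r = 3 * (L * (q ^ (m + 1) * r)) := by ring
        rw [dist_comm] at huu
        linarith [dist_triangle4 u₀ u v v₀]
      · linarith [hsep x hx y hy hxa hyb hdis u hu v hv]

/-- Separated covers exist at every scale, with constants depending only on the linear
connectivity and doubling constants. -/
theorem exists_isSeparatedCover {L : ℝ} (hL : 1 ≤ L) (N : ℕ) :
    ∃ C c : ℝ, 1 ≤ C ∧ 0 < c ∧ c ≤ 1 ∧ ∀ (X : Type*) [MetricSpace X],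
      IsLinearlyConnected X L → IsDoubling X N → ∀ r > 0,
        ∃ V : X → Set X, IsSeparatedCover V C c r := by
  have hL0 : 0 < L := by linarith
  obtain ⟨m, hm⟩ := pow_unbounded_of_one_lt (2 * (6 * (2 * L + 1) + 1)) (one_lt_two (α := ℝ))
  set M := N ^ m + 1 with hM
  have hq0 : 0 < 1 / (8 * L) := by positivity
  have hq1 : 1 / (8 * L) ≤ 1 / 8 := by
    apply one_div_le_one_div_of_le <;> linarith
  have hc1 : 3 * L * (1 / (8 * L)) ^ (M * M + 1) ≤ 1 := by
    have h1 : 3 * L * (1 / (8 * L)) ^ (M * M + 1) = 3 / 8 * (1 / (8 * L)) ^ (M * M) := by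
      rw [pow_succ]; field_simp
    have h2 : (1 / (8 * L)) ^ (M * M) ≤ 1 := pow_le_one₀ hq0.le (by linarith)
    rw [h1]; linarith
  refine ⟨2 * L + 2, 3 * L * (1 / (8 * L)) ^ (M * M + 1), by linarith, by positivity, hc1, ?_⟩
  intro X _ hX hN r hr
  obtain ⟨P, hP, hPc⟩ := exists_maximal_separated X hr
  let adj : X → X → Prop := fun x y => x ∈ P ∧ y ∈ P ∧ dist x y ≤ 6 * (2 * L + 1) * r
  obtain ⟨κ, hκM, hκ⟩ := exists_coloring adj
    (fun x y h => ⟨h.2.1, h.1, by rw [dist_comm]; exact h.2.2⟩) M (by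
      intro x
      have hR : 0 < (6 * (2 * L + 1) + 1) * r := by positivity
      refine lt_of_le_of_lt (hN.encard_le_of_separated (m := m) (x := x) hR ?_ ?_
        (hP.mono fun y hy => hy.2.1)) (b := ((N ^ m : ℕ) : ℕ∞)) ?_
      · rw [← mul_div_assoc, div_le_iff₀ (by positivity)]
        nlinarith
      · intro y hy
        rw [mem_ball']
        have := hy.2.2
        linarith
      · exact_mod_cast Nat.lt_succ_self _)
  -- Quotient and remainder by `M` run through all ordered pairs of colours.
  obtain ⟨V, hV, hV2, hVC, hVs⟩ := hX.exists_iterate_join hL (P := P) (κ := κ) hr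
    (fun x hx y hy hxy hne => by
      by_contra! h
      exact hκ x y ⟨hx, hy, h⟩ hne hxy) (fun i => i / M) (fun i => i % M) (M * M)
  choose p hpP hp using hPc
  have hMpos : 0 < M := Nat.succ_pos _
  refine ⟨fun x => V (p x), fun x => hV _, fun x y hxy => hV2 _ _ ?_, fun x z hz => ?_,
    fun x y hdis u hu v hv => ?_⟩
  · have := hp x
    rw [dist_comm] at this
    linarith [dist_triangle (p x) x y]
  · have h1 := mem_closedBall.1 (hVC _ hz)
    have h2 := hp x
    rw [dist_comm] at h2
    have h3 : (2 * L + 1 - (1 / 2) ^ (M * M)) * r ≤ (2 * L + 1) * r := by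
      gcongr
      have : (0 : ℝ) < (1 / 2) ^ (M * M) := by positivity
      linarith
    rw [mem_closedBall]
    linarith [dist_triangle z (p x) x]
  · have hy := hκM (p y)
    have hx := hκM (p x)
    refine hVs (κ (p x) * M + κ (p y)) ?_ (p x) (hpP x) (p y) (hpP y) ?_ ?_ hdis u hu v hv
    · nlinarith
    · show κ (p x) = (κ (p x) * M + κ (p y)) / M
      rw [mul_comm, Nat.mul_add_div hMpos, Nat.div_eq_of_lt hy, add_zero]
    · show κ (p y) = (κ (p x) * M + κ (p y)) % M
      rw [mul_comm, Nat.mul_add_mod, Nat.mod_eq_of_lt hy]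

end Cover

/-! ### Simple chains and their refinement -/

section Chains

/-- Loop erasure: a walk whose steps satisfy `E` contains a subsequence that is an induced path
for `E`. -/
theorem exists_induced_path {σ : Type*} {R E : σ → σ → Prop} (hRE : ∀ s t, R s t → E s t)
    {s t : σ} (h : ReflTransGen R s t) :
    ∃ (k : ℕ) (z : ℕ → σ), z 0 = s ∧ z k = t ∧
      (∀ i < k, E (z i) (z (i + 1)) ∧ ReflTransGen R (z i) (z (i + 1))) ∧
      ∀ i j, i + 2 ≤ j → j ≤ k → ¬ E (z i) (z j) := by
  classical
  induction h using ReflTransGen.head_induction_on with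
  | refl => exact ⟨0, fun _ => t, rfl, rfl, by simp, fun i j h1 h2 => by omega⟩
  | @head s u hsu _ ih =>
    obtain ⟨k, z, hz0, hzk, hz, hzE⟩ := ih
    have hreach : ∀ j ≤ k, ReflTransGen R s (z j) := by
      intro j
      induction j with
      | zero => intro _; rw [hz0]; exact .single hsu
      | succ j ihj => intro hj; exact (ihj (by omega)).trans (hz j (by omega)).2
    -- Jumping from `s` to the last vertex adjacent to it leaves no edge from `s` to any later
    -- vertex.
    set j := Nat.findGreatest (fun j => E s (z j)) k with hj
    have hjk : j ≤ k := Nat.findGreatest_le k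
    have hjE : E s (z j) := Nat.findGreatest_spec (P := fun j => E s (z j)) (Nat.zero_le k)
      (by rw [hz0]; exact hRE _ _ hsu)
    refine ⟨k - j + 1, fun i => if i = 0 then s else z (j + (i - 1)), by simp, ?_, ?_, ?_⟩
    · simp only [Nat.add_eq_zero_iff, one_ne_zero, and_false, if_false, Nat.add_sub_cancel]
      rwa [Nat.add_sub_cancel' hjk]
    · rintro (_ | i) hi
      · simpa using ⟨hjE, hreach j hjk⟩
      · simpa [add_assoc] using hz (j + i) (by omega)
    · rintro (_ | i) (_ | l) hil hl
      · omega
      · simpa using Nat.findGreatest_is_greatest (P := fun j => E s (z j)) (n := k)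
          (k := j + l) (by omega) (by omega)
      · omega
      · simpa using hzE (j + i) (j + l) (by omega) (by omega)

variable {X : Type*} [MetricSpace X]

/-- The points `x 0 = a, …, x k = b` index a chain of sets in which exactly the consecutive
members meet. -/
structure IsSimpleChain (V : X → Set X) (a b : X) (k : ℕ) (x : ℕ → X) : Prop where
  zero : x 0 = a
  last : x k = b
  inter : ∀ i < k, (V (x i) ∩ V (x (i + 1))).Nonempty
  disjoint : ∀ i j, i + 2 ≤ j → j ≤ k → Disjoint (V (x i)) (V (x j))

/-- Steps of size at most `r` through the sets `U i`, with nondecreasing labels `i`. -/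
def LabelledStep {I : Type*} [Preorder I] (U : I → Set X) (r : ℝ) (s t : X × I) : Prop :=
  dist s.1 t.1 ≤ r ∧ s.2 ≤ t.2 ∧ t.1 ∈ U t.2

/-- Labels stay monotone under loop erasure because consecutive survivors are still joined by a walk
of labelled steps. The labels are parameters of `A` for the initial chain and indices of the coarser
chain for a refinement. -/
theorem exists_labelled_simpleChain {I : Type*} [Preorder I] {U : I → Set X} {r : ℝ}
    {V : X → Set X} (hr : 0 ≤ r) (hV : ∀ x y, dist x y ≤ r → y ∈ V x) {a b : X} {i₀ i₁ : I}
    (ha : a ∈ U i₀) (h : ReflTransGen (LabelledStep U r) (a, i₀) (b, i₁)) :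
    ∃ (k : ℕ) (x : ℕ → X) (l : ℕ → I), IsSimpleChain V a b k x ∧ l 0 = i₀ ∧ l k = i₁ ∧
      (∀ j < k, l j ≤ l (j + 1)) ∧ ∀ j ≤ k, x j ∈ U (l j) := by
  obtain ⟨k, z, hz0, hzk, hz, hzE⟩ := exists_induced_path
    (E := fun s t : X × I => (V s.1 ∩ V t.1).Nonempty)
    (fun s t hst => ⟨t.1, hV _ _ hst.1, hV _ _ (by simpa using hr)⟩) h
  have hmono : ∀ s t, ReflTransGen (LabelledStep U r) s t → s.2 ≤ t.2 ∧ (s.1 ∈ U s.2 → t.1 ∈ U t.2) := by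
    intro s t hst
    induction hst with
    | refl => exact ⟨le_rfl, id⟩
    | tail _ h1 ih => exact ⟨ih.1.trans h1.2.1, fun _ => h1.2.2⟩
  refine ⟨k, fun j => (z j).1, fun j => (z j).2, ⟨by simp [hz0], by simp [hzk],
    fun i hi => (hz i hi).1, fun i j hij hj => ?_⟩, by simp [hz0], by simp [hzk],
    fun j hj => (hmono _ _ (hz j hj).2).1, fun j => ?_⟩
  · exact not_nonempty_iff_eq_empty.1 (hzE i j hij hj) |> disjoint_iff_inter_eq_empty.2
  · induction j with
    | zero => intro _; simpa [hz0] using ha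
    | succ j ih => intro hj; exact (hmono _ _ (hz j (by omega)).2).2 (ih (by omega))

theorem IsPreconnected.reflTransGen_labelledStep {I : Type*} [Preorder I] {U : I → Set X} {r : ℝ}
    (hr : 0 < r) {i : I} (hU : IsPreconnected (U i)) {u v : X} (hu : u ∈ U i) (hv : v ∈ U i) :
    ReflTransGen (LabelledStep U r) (u, i) (v, i) := by
  refine hU.induction₂' (fun u v => ReflTransGen (LabelledStep U r) (u, i) (v, i)) ?_
    (fun _ _ _ _ _ _ => ReflTransGen.trans) hu hv
  intro x hx
  filter_upwards [self_mem_nhdsWithin, mem_nhdsWithin_of_mem_nhds (closedBall_mem_nhds x hr)]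
    with y hy hyx
  exact ⟨.single ⟨mem_closedBall'.1 hyx, le_rfl, hy⟩, .single ⟨mem_closedBall.1 hyx, le_rfl, hx⟩⟩

/-- Connectedness allows small steps inside each `V (x i)`; the label is raised while standing still
at a point common to two consecutive sets. -/
theorem IsSimpleChain.exists_walk {V : X → Set X} {a b : X} {k : ℕ} {x : ℕ → X}
    (hx : IsSimpleChain V a b k x) (hV : ∀ x, IsPreconnected (V x)) (hVx : ∀ x, x ∈ V x)
    {r : ℝ} (hr : 0 < r) :
    ReflTransGen (LabelledStep (fun i => V (x i)) r) (a, 0) (b, k) := by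
  have key : ∀ i ≤ k, ∀ u ∈ V (x i),
      ReflTransGen (LabelledStep (fun i => V (x i)) r) (a, 0) (u, i) := by
    intro i
    induction i with
    | zero =>
      intro _ u hu
      exact IsPreconnected.reflTransGen_labelledStep (U := fun i => V (x i)) hr (hV _)
        (by rw [← hx.zero]; exact hVx _) hu
    | succ i ih =>
      intro hi u hu
      obtain ⟨w, hw, hw'⟩ := hx.inter i (by omega)
      refine ((ih (by omega) w hw).tail (c := (w, i + 1))
        ⟨by simpa using hr.le, Nat.le_succ i, hw'⟩).trans ?_
      exact IsPreconnected.reflTransGen_labelledStep (U := fun i => V (x i)) hr (hV _) hw' hu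
  exact key k le_rfl b (by rw [← hx.last]; exact hVx _)

theorem exists_walk_of_path (γ : C(unitInterval, X)) {r : ℝ} (hr : 0 < r) :
    ReflTransGen (LabelledStep (fun t => {γ t}) r) (γ 0, (0 : unitInterval))
      (γ 1, (1 : unitInterval)) := by
  obtain ⟨t, ht0, htm, ⟨n, hn⟩, htc⟩ := exists_monotone_Icc_subset_open_cover_unitInterval
    (c := fun p : X => γ ⁻¹' ball p (r / 2)) (fun p => isOpen_ball.preimage γ.continuous)
    (fun s _ => mem_iUnion.2 ⟨γ s, mem_ball_self (by positivity)⟩)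
  have key : ∀ m, ReflTransGen (LabelledStep (fun t => {γ t}) r) (γ 0, (0 : unitInterval))
      (γ (t m), t m) := by
    intro m
    induction m with
    | zero => rw [ht0]
    | succ m ih =>
      obtain ⟨p, hp⟩ := htc m
      have hle := htm (Nat.le_succ m)
      have h1 := mem_ball.1 (hp (left_mem_Icc.2 hle))
      have h2 := mem_ball'.1 (hp (right_mem_Icc.2 hle))
      refine ih.tail ⟨?_, hle, rfl⟩
      show dist (γ (t m)) (γ (t (m + 1))) ≤ r
      linarith [dist_triangle (γ (t m)) p (γ (t (m + 1)))]
  simpa [hn n le_rfl] using key n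

theorem IsSeparatedCover.dist_le_of_inter {V : X → Set X} {C c r : ℝ}
    (hV : IsSeparatedCover V C c r) {x y : X} (h : (V x ∩ V y).Nonempty) :
    dist x y ≤ 2 * C * r := by
  obtain ⟨w, hw, hw'⟩ := h
  have h1 := mem_closedBall'.1 (hV.subset_closedBall x hw)
  have h2 := mem_closedBall.1 (hV.subset_closedBall y hw')
  linarith [dist_triangle x w y]

/-- A simple chain at scale `r` is refined by a simple chain at a much smaller scale `r'`. -/
theorem IsSimpleChain.exists_refinement {V V' : X → Set X} {C c r r' : ℝ} (hC : 1 ≤ C)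
    (hr' : 0 < r') (hr : 0 < r) (hrr : 10 * C * r' < c * r)
    (hV : IsSeparatedCover V C c r) (hV' : IsSeparatedCover V' C c r') {a b : X} {k : ℕ}
    {x : ℕ → X} (hx : IsSimpleChain V a b k x) :
    ∃ (k' : ℕ) (x' : ℕ → X) (l : ℕ → ℕ), IsSimpleChain V' a b k' x' ∧ l 0 = 0 ∧ l k' = k ∧
      (∀ j < k', l j ≤ l (j + 1) ∧ l (j + 1) ≤ l j + 1) ∧
      (∀ j ≤ k', ∃ v ∈ V (x (l j)), dist (x' j) v ≤ 2 * C * r') ∧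
      (4 * C * r' < dist a b → ∀ i ≤ k, ∃ j < k', l j = i ∧ l (j + 1) = i) := by
  have hVx : ∀ x, x ∈ V x := fun x => hV.mem_of_dist_le x x (by simpa using hr.le)
  obtain ⟨k', x', l₀, hx', hl0, hlk, hlm, hlU⟩ := exists_labelled_simpleChain hr'.le
    hV'.mem_of_dist_le (by show a ∈ V (x 0); rw [← hx.zero]; exact hVx _)
    (hx.exists_walk hV.isPreconnected hVx hr')
  have hCr' : 0 < C * r' := by positivity
  have hstep : ∀ j < k', dist (x' j) (x' (j + 1)) ≤ 2 * C * r' := fun j hj =>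
    hV'.dist_le_of_inter (hx'.inter j hj)
  have hl₀mono : ∀ i j, i ≤ j → j ≤ k' → l₀ i ≤ l₀ j := by
    intro i j hij
    induction j, hij using Nat.le_induction with
    | base => intro _; exact le_rfl
    | succ j _ ih => intro hj; exact (ih (by omega)).trans (hlm j (by omega))
  have hl₀k : ∀ j ≤ k', l₀ j ≤ k := fun j hj => hlk ▸ hl₀mono j k' hj le_rfl
  have hclose : ∀ i j, i ≤ k → j ≤ k → ∀ u ∈ V (x i), ∀ v ∈ V (x j), dist u v < c * r →
      j ≤ i + 1 := by
    intro i j _ hj u hu v hv huv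
    by_contra! h
    exact absurd (hV.le_dist _ _ (hx.disjoint i j h hj) u hu v hv) (not_le.2 huv)
  -- the two outermost members at each end receive the extreme labels
  obtain ⟨l, hl0, hlk, hlm, hlU, hends⟩ : ∃ l : ℕ → ℕ, l 0 = 0 ∧ l k' = k ∧
      (∀ j < k', l j ≤ l (j + 1)) ∧
      (∀ j ≤ k', ∃ v ∈ V (x (l j)), dist (x' j) v ≤ 2 * C * r') ∧
      (3 ≤ k' → l 1 = 0 ∧ l (k' - 1) = k) := by
    -- The repetition of interior labels comes from the step bound below; at the two ends it is
    -- imposed by hand.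
    by_cases hk : 3 ≤ k'
    · refine ⟨fun j => if j ≤ 1 then 0 else if k' ≤ j + 1 then k else l₀ j, by simp, ?_, ?_, ?_, ?_⟩
      · simp only; split_ifs <;> omega
      · intro j hj
        have h1 := hlm j hj
        have h2 := hl₀k j (by omega)
        simp only; split_ifs <;> omega
      · intro j hj
        simp only
        split_ifs with h1 h2
        · obtain rfl | rfl : j = 0 ∨ j = 1 := by omega
          · exact ⟨x 0, hVx _, by rw [hx'.zero, hx.zero, dist_self]; positivity⟩
          · refine ⟨x 0, hVx _, ?_⟩
            rw [hx.zero, ← hx'.zero, dist_comm]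
            exact hstep 0 (by omega)
        · obtain rfl | rfl : j = k' ∨ k' = j + 1 := by omega
          · exact ⟨x k, hVx _, by rw [hx'.last, hx.last, dist_self]; positivity⟩
          · refine ⟨x k, hVx _, ?_⟩
            rw [hx.last, ← hx'.last]
            exact hstep j (by omega)
        · exact ⟨x' j, hlU j hj, by rw [dist_self]; positivity⟩
      · intro _
        simp only
        refine ⟨by simp, ?_⟩
        split_ifs <;> omega
    · exact ⟨l₀, hl0, hlk, hlm, fun j hj => ⟨x' j, hlU j hj, by rw [dist_self]; positivity⟩,
        fun h => absurd h hk⟩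
  have hmono : ∀ i j, i ≤ j → j ≤ k' → l i ≤ l j := by
    intro i j hij
    induction j, hij using Nat.le_induction with
    | base => intro _; exact le_rfl
    | succ j _ ih => intro hj; exact (ih (by omega)).trans (hlm j (by omega))
  have hlk' : ∀ j ≤ k', l j ≤ k := fun j hj => hlk ▸ hmono j k' hj le_rfl
  -- Two fine steps cover at most `4 * C * r'`, too little to skip a coarse set. So a label rises by
  -- at most one in two steps, and a newly reached label is held for two consecutive members.
  have hlip : ∀ i ≤ k', ∀ j ≤ k', dist (x' i) (x' j) ≤ 4 * C * r' → l j ≤ l i + 1 := by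
    intro i hi j hj hij
    obtain ⟨u, hu, hud⟩ := hlU i hi
    obtain ⟨v, hv, hvd⟩ := hlU j hj
    refine hclose _ _ (hlk' i hi) (hlk' j hj) u hu v hv ?_
    rw [dist_comm] at hud
    linarith [dist_triangle4 u (x' i) (x' j) v]
  have hsucc : ∀ j < k', l (j + 1) ≤ l j + 1 := fun j hj =>
    hlip j hj.le (j + 1) hj (by linarith [hstep j hj])
  refine ⟨k', x', l, hx', hl0, hlk, fun j hj => ⟨hlm j hj, hsucc j hj⟩, hlU, fun hab i hi => ?_⟩
  have htwo : ∀ j, j + 2 ≤ k' → dist (x' j) (x' (j + 2)) ≤ 4 * C * r' := fun j hj => by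
    linarith [dist_triangle (x' j) (x' (j + 1)) (x' (j + 2)), hstep j (by omega),
      hstep (j + 1) (by omega)]
  have hk3 : 3 ≤ k' := by
    by_contra! h
    rw [← hx'.zero, ← hx'.last] at hab
    interval_cases k'
    · rw [dist_self] at hab; linarith
    · linarith [hstep 0 (by omega)]
    · linarith [htwo 0 (by omega)]
  obtain ⟨h1, h2⟩ := hends hk3
  classical
  -- the first member labelled `i`
  have hex : ∃ j, i ≤ l j := ⟨k', by rw [hlk]; exact hi⟩
  set j := Nat.find hex with hj
  have hij : i ≤ l j := Nat.find_spec hex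
  have hjk : j ≤ k' := Nat.find_min' hex (by rw [hlk]; exact hi)
  rcases Nat.eq_zero_or_pos j with hj0 | hjpos
  · rw [hj0, hl0] at hij
    exact ⟨0, by omega, by omega, by rw [zero_add, h1]; omega⟩
  have hlt : l (j - 1) < i := not_le.1 (Nat.find_min hex (m := j - 1) (by omega))
  have hj1 := hsucc (j - 1) (by omega)
  rw [Nat.sub_add_cancel hjpos] at hj1
  have hji : l j = i := by omega
  rcases eq_or_lt_of_le hjk with hjk | hjk
  · rw [hjk] at hlt
    omega
  · refine ⟨j, hjk, hji, ?_⟩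
    have h3 := hlip (j - 1) (by omega) (j + 1) hjk (by
      have := htwo (j - 1) (by omega)
      rwa [show j - 1 + 2 = j + 1 by omega] at this)
    have h4 := hlm j hjk
    omega

end Chains

/-! ### Nested subdivisions of the unit interval -/

section Subdivision

/-- Breakpoints `W 0 < ⋯ < W (k + 1)` can be refined so that the intervals with label `i` subdivide
the `i`-th one into equal parts. -/
theorem exists_refined_breakpoints {k k' : ℕ} {l : ℕ → ℕ} (hl0 : l 0 = 0) (hlk : l k' = k)
    (hl : ∀ j < k', l j ≤ l (j + 1) ∧ l (j + 1) ≤ l j + 1) {W : ℕ → ℝ}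
    (hW : ∀ i ≤ k, W i < W (i + 1)) :
    ∃ W' : ℕ → ℝ, W' 0 = W 0 ∧ W' (k' + 1) = W (k + 1) ∧ (∀ j ≤ k', W' j < W' (j + 1)) ∧
      (∀ j ≤ k', W (l j) ≤ W' j ∧ W' (j + 1) ≤ W (l j + 1)) ∧
      ∀ j ≤ k', W' (j + 1) - W' j ≤ W (l j + 1) - W (l j) ∧
        ((∃ i < k', l i = l j ∧ l (i + 1) = l j) →
          W' (j + 1) - W' j ≤ (W (l j + 1) - W (l j)) / 2) := by
  have hmono : ∀ i j, i ≤ j → j ≤ k' → l i ≤ l j := by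
    intro i j hij
    induction j, hij using Nat.le_induction with
    | base => intro _; exact le_rfl
    | succ j _ ih => intro hj; exact (ih (by omega)).trans (hl j (by omega)).1
  have hlk' : ∀ j ≤ k', l j ≤ k := fun j hj => hlk ▸ hmono j k' hj le_rfl
  let cnt : ℕ → ℕ → ℕ := fun n i => ((Finset.range n).filter fun j => l j = i).card
  let gap : ℕ → ℝ := fun i => W (i + 1) - W i
  let part : ℕ → ℝ := fun j => gap (l j) / cnt (k' + 1) (l j)
  have hcnt_succ : ∀ n i, cnt (n + 1) i = cnt n i + if l n = i then 1 else 0 := by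
    intro n i
    simp only [cnt, Finset.range_add_one, Finset.filter_insert]
    split_ifs <;> simp
  have hcnt_mono : ∀ m n i, m ≤ n → cnt m i ≤ cnt n i := fun m n i h =>
    Finset.card_le_card (Finset.filter_subset_filter _ (Finset.range_mono h))
  have hcnt_pos : ∀ j ≤ k', 0 < cnt (k' + 1) (l j) := fun j hj =>
    Finset.card_pos.2 ⟨j, by simp; omega⟩
  have hgap : ∀ j ≤ k', 0 < gap (l j) := fun j hj => sub_pos.2 (hW _ (hlk' j hj))
  have hpart : ∀ j ≤ k', 0 < part j := fun j hj =>
    div_pos (hgap j hj) (by exact_mod_cast hcnt_pos j hj)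
  let W' : ℕ → ℝ := fun n => W 0 + ∑ j ∈ Finset.range n, part j
  have hW'succ : ∀ j, W' (j + 1) = W' j + part j := fun j => by
    simp only [W', Finset.sum_range_succ, add_assoc]
  have hcnt_zero : ∀ j ≤ k', ∀ i, l j < i → cnt (j + 1) i = 0 := by
    intro j hj i hi
    refine Finset.card_eq_zero.2 (Finset.filter_eq_empty_iff.2 fun m hm h => ?_)
    have := hmono m j (by simp at hm; omega) hj
    omega
  have hcnt_full : ∀ j < k', l j < l (j + 1) → cnt (k' + 1) (l j) = cnt (j + 1) (l j) := by
    intro j hj hlt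
    refine congrArg Finset.card (Finset.ext fun m => ?_)
    simp only [Finset.mem_filter, Finset.mem_range]
    refine ⟨fun ⟨h1, h2⟩ => ⟨?_, h2⟩, fun ⟨h1, h2⟩ => ⟨by omega, h2⟩⟩
    by_contra h
    have := hmono (j + 1) m (by omega) (by omega)
    omega
  have hmul : ∀ j ≤ k', cnt (k' + 1) (l j) * part j = gap (l j) := fun j hj =>
    mul_div_cancel₀ _ (by exact_mod_cast (hcnt_pos j hj).ne')
  -- Before the `j`-th interval, `cnt j (l j)` of the equal parts of the coarse interval `l j` are
  -- already used up.
  have hform : ∀ j ≤ k', W' j = W (l j) + cnt j (l j) * part j := by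
    intro j
    induction j with
    | zero => intro _; simp [W', cnt, hl0]
    | succ j ih =>
      intro hj
      rw [hW'succ, ih (by omega)]
      obtain ⟨h1, h2⟩ := hl j hj
      rcases h1.eq_or_lt with h | h
      · have hp : part (j + 1) = part j := by simp only [part, ← h]
        rw [hp, ← h, hcnt_succ, if_pos rfl]
        push_cast
        ring
      · have h3 : l (j + 1) = l j + 1 := by omega
        rw [hcnt_zero j (by omega) _ h, h3]
        have h4 := hmul j (by omega)
        rw [hcnt_full j hj h, hcnt_succ, if_pos rfl] at h4
        push_cast at h4
        simp only [gap] at h4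
        push_cast
        linarith
  have hupper : ∀ j ≤ k', W' (j + 1) = W (l j) + cnt (j + 1) (l j) * part j := fun j hj => by
    rw [hW'succ, hform j hj, hcnt_succ, if_pos rfl]
    push_cast
    ring
  have hupper_le : ∀ j ≤ k', W' (j + 1) ≤ W (l j + 1) := fun j hj => by
    rw [hupper j hj]
    have h1 : (cnt (j + 1) (l j) : ℝ) ≤ cnt (k' + 1) (l j) := by
      exact_mod_cast hcnt_mono _ _ _ (by omega)
    have h2 := mul_le_mul_of_nonneg_right h1 (hpart j hj).le
    rw [hmul j hj] at h2
    simp only [gap] at h2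
    linarith
  have hlower : ∀ j ≤ k', W (l j) ≤ W' j := fun j hj => by
    rw [hform j hj]
    have := mul_nonneg (Nat.cast_nonneg (α := ℝ) (cnt j (l j))) (hpart j hj).le
    linarith
  refine ⟨W', by simp [W'], ?_, fun j hj => ?_, fun j hj => ⟨hlower j hj, hupper_le j hj⟩,
    fun j hj => ⟨?_, ?_⟩⟩
  · have := hmul k' le_rfl
    rw [hupper k' le_rfl, this, hlk]
    simp [gap]
  · rw [hW'succ]
    linarith [hpart j hj]
  · linarith [hlower j hj, hupper_le j hj]
  · rintro ⟨i, hi, hij, hij'⟩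
    have h2 : 2 ≤ cnt (k' + 1) (l j) := by
      calc 2 = ({i, i + 1} : Finset ℕ).card := by simp
        _ ≤ _ := Finset.card_le_card fun m hm => by
          simp only [Finset.mem_insert, Finset.mem_singleton] at hm
          rcases hm with rfl | rfl <;> simp <;> omega
    have h2' : (2 : ℝ) ≤ cnt (k' + 1) (l j) := by exact_mod_cast h2
    have h3 := mul_le_mul_of_nonneg_right h2' (hpart j hj).le
    rw [hmul j hj] at h3
    rw [hW'succ]
    simp only [gap] at h3
    linarith

/-- The index of the interval `[W j, W (j + 1))` containing `t`. -/
theorem exists_index_function {k : ℕ} {W : ℕ → ℝ} (hW0 : W 0 = 0)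
    (hW : ∀ i ≤ k, W i < W (i + 1)) :
    ∃ idx : unitInterval → ℕ, (∀ t, idx t ≤ k ∧ W (idx t) ≤ t ∧ (idx t < k → (t : ℝ) < W (idx t + 1))) ∧
      ∀ t : unitInterval, ∀ j ≤ k, W j ≤ t → (j < k → (t : ℝ) < W (j + 1)) → idx t = j := by
  classical
  have hmono : ∀ i j, i ≤ j → j ≤ k + 1 → W i ≤ W j := by
    intro i j hij
    induction j, hij using Nat.le_induction with
    | base => intro _; exact le_rfl
    | succ j _ ih => intro hj; exact (ih (by omega)).trans (hW j (by omega)).le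
  have hspec : ∀ t : unitInterval, W (Nat.findGreatest (fun j => W j ≤ t) k) ≤ t := fun t =>
    Nat.findGreatest_spec (P := fun j => W j ≤ t) (Nat.zero_le k) (by rw [hW0]; exact t.2.1)
  -- The search is capped at `k`, so the last interval is closed and `t = 1` receives the index `k`.
  refine ⟨fun t => Nat.findGreatest (fun j => W j ≤ t) k, fun t =>
    ⟨Nat.findGreatest_le k, hspec t, fun h => ?_⟩, fun t j hj h1 h2 => ?_⟩
  · exact not_le.1 (Nat.findGreatest_is_greatest (P := fun j => W j ≤ t) (Nat.lt_succ_self _) h)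
  · have h3 : j ≤ Nat.findGreatest (fun j => W j ≤ t) k := Nat.le_findGreatest hj h1
    rcases h3.eq_or_lt with h | h
    · exact h.symm
    · have h4 := Nat.findGreatest_le (P := fun j => W j ≤ t) k
      have h5 := hmono (j + 1) _ h (by omega)
      linarith [hspec t, h2 (by omega)]

/-- An inverse system of finite ordered chains, in which eventually every member splits, is
compatibly indexed by the unit interval. -/
theorem exists_compatible_indices {k : ℕ → ℕ} {l : ℕ → ℕ → ℕ} (hl0 : ∀ n, l n 0 = 0)
    (hlk : ∀ n, l n (k (n + 1)) = k n)
    (hl : ∀ n, ∀ j < k (n + 1), l n j ≤ l n (j + 1) ∧ l n (j + 1) ≤ l n j + 1)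
    {n₀ : ℕ} (hsplit : ∀ n ≥ n₀, ∀ i ≤ k n, ∃ j < k (n + 1), l n j = i ∧ l n (j + 1) = i) :
    ∃ idx : ℕ → unitInterval → ℕ, (∀ n, Monotone (idx n)) ∧ (∀ n, idx n 0 = 0) ∧
      (∀ n, idx n 1 = k n) ∧ (∀ n t, idx n t ≤ k n) ∧
      (∀ n t, l n (idx (n + 1) t) = idx n t) ∧
      (∀ n, ∃ g > 0, ∀ s t, dist s t < g → idx n t ≤ idx n s + 1) ∧
      ∀ s t, s < t → ∃ n, idx n s + 2 ≤ idx n t := by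
  let B : ℕ → Type := fun n =>
    {W : ℕ → ℝ // W 0 = 0 ∧ W (k n + 1) = 1 ∧ ∀ i ≤ k n, W i < W (i + 1)}
  have hrefine : ∀ n (W : B n), ∃ W' : B (n + 1),
      (∀ j ≤ k (n + 1), W.1 (l n j) ≤ W'.1 j ∧ W'.1 (j + 1) ≤ W.1 (l n j + 1)) ∧
      ∀ j ≤ k (n + 1), W'.1 (j + 1) - W'.1 j ≤ W.1 (l n j + 1) - W.1 (l n j) ∧
        ((∃ i < k (n + 1), l n i = l n j ∧ l n (i + 1) = l n j) →
          W'.1 (j + 1) - W'.1 j ≤ (W.1 (l n j + 1) - W.1 (l n j)) / 2) := by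
    rintro n ⟨W, h0, h1, hW⟩
    obtain ⟨W', h0', h1', hW', hsub, hgap⟩ :=
      exists_refined_breakpoints (hl0 n) (hlk n) (hl n) hW
    exact ⟨⟨W', h0'.trans h0, h1'.trans h1, hW'⟩, hsub, hgap⟩
  choose next hnext hgap using hrefine
  let W₀ : B 0 := ⟨fun i => i / (k 0 + 1 : ℝ), by simp, by
    push_cast; field_simp, fun i _ => by push_cast; gcongr; linarith⟩
  let W : ∀ n, B n := fun n => Nat.rec W₀ next n
  have hWsucc : ∀ n, W (n + 1) = next n (W n) := fun n => rfl
  have hW0 : ∀ n, (W n).1 0 = 0 := fun n => (W n).2.1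
  have hWk : ∀ n, (W n).1 (k n + 1) = 1 := fun n => (W n).2.2.1
  have hWlt : ∀ n, ∀ i ≤ k n, (W n).1 i < (W n).1 (i + 1) := fun n => (W n).2.2.2
  have hmono : ∀ n i j, i ≤ j → j ≤ k n + 1 → (W n).1 i ≤ (W n).1 j := by
    intro n i j hij
    induction j, hij using Nat.le_induction with
    | base => intro _; exact le_rfl
    | succ j _ ih => intro hj; exact (ih (by omega)).trans (hWlt n j (by omega)).le
  choose idx hidx huniq using fun n => exists_index_function (hW0 n) (hWlt n)
  have hlmono : ∀ n i j, i ≤ j → j ≤ k (n + 1) → l n i ≤ l n j := by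
    intro n i j hij
    induction j, hij using Nat.le_induction with
    | base => intro _; exact le_rfl
    | succ j _ ih => intro hj; exact (ih (by omega)).trans (hl n j (by omega)).1
  have hlle : ∀ n, ∀ j ≤ k (n + 1), l n j ≤ k n := fun n j hj =>
    (hlmono n j _ hj le_rfl).trans (hlk n).le
  have hmesh : ∀ m, ∀ j ≤ k (n₀ + m), (W (n₀ + m)).1 (j + 1) - (W (n₀ + m)).1 j ≤ (1 / 2) ^ m := by
    intro m
    induction m with
    | zero =>
      intro j hj
      have h1 := hmono (n₀ + 0) 0 j (by omega) (by omega)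
      have h2 := hmono (n₀ + 0) (j + 1) _ (by omega) le_rfl
      rw [hW0] at h1
      rw [hWk] at h2
      rw [pow_zero]
      linarith
    | succ m ih =>
      intro j hj
      have h1 := (hgap (n₀ + m) (W (n₀ + m)) j hj).2
        (hsplit _ (by omega) _ (hlle _ j hj))
      have h2 := ih _ (hlle _ j hj)
      rw [pow_succ]
      refine h1.trans ?_
      linarith
  have hidxmono : ∀ n, Monotone (idx n) := by
    intro n s t hst
    by_contra! h
    have h1 := (hidx n t).2.2 (h.trans_le (hidx n s).1)
    have h2 := hmono n (idx n t + 1) (idx n s) h (by have := (hidx n s).1; omega)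
    have h3 : (s : ℝ) ≤ t := hst
    linarith [(hidx n s).2.1]
  refine ⟨idx, hidxmono, fun n => ?_, fun n => ?_, fun n t => (hidx n t).1, fun n t => ?_,
    fun n => ?_, fun s t hst => ?_⟩
  · refine huniq n 0 0 (Nat.zero_le _) (by rw [hW0]; simp) fun _ => ?_
    have := hWlt n 0 (Nat.zero_le _)
    rw [hW0] at this
    simpa using this
  · refine huniq n 1 (k n) le_rfl ?_ fun h => absurd h (lt_irrefl _)
    have := hmono n (k n) (k n + 1) (by omega) le_rfl
    rw [hWk] at this
    simpa using this
  · obtain ⟨h1, h2, h3⟩ := hidx (n + 1) t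
    obtain ⟨h4, h5⟩ := hnext n (W n) (idx (n + 1) t) h1
    rw [← hWsucc] at h4 h5
    refine (huniq n t _ (hlle n _ h1) (h4.trans h2) fun h => ?_).symm
    rcases h1.eq_or_lt with h6 | h6
    · rw [h6, hlk] at h
      exact absurd h (lt_irrefl _)
    · exact (h3 h6).trans_le h5
  -- A move shorter than the shortest interval cannot jump over a whole interval.
  · obtain ⟨j, hj, hjmin⟩ := Finset.exists_min_image (Finset.range (k n + 1))
      (fun j => (W n).1 (j + 1) - (W n).1 j) ⟨0, by simp⟩
    refine ⟨_, sub_pos.2 (hWlt n j (by simp at hj; omega)), fun s t hst => ?_⟩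
    by_contra! h
    have h1 := (hidx n t).1
    have h2 := (hidx n s).2.2 (by omega)
    have h3 := hmono n (idx n s + 1 + 1) (idx n t) h (by omega)
    have h4 := hjmin (idx n s + 1) (by simp; omega)
    have h5 := (hidx n t).2.1
    rw [Subtype.dist_eq, Real.dist_eq] at hst
    have h6 := (abs_lt.1 hst).1
    linarith
  · have hst' : (0 : ℝ) < (t - s) / 2 := by
      have : (s : ℝ) < t := hst
      linarith
    obtain ⟨m, hm⟩ := exists_pow_lt_of_lt_one hst' (by norm_num : (1 / 2 : ℝ) < 1)
    refine ⟨n₀ + m, ?_⟩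
    by_contra! h
    have hs := hidx (n₀ + m) s
    have ht := hidx (n₀ + m) t
    have hle := hidxmono (n₀ + m) hst.le
    have h1 : (t : ℝ) ≤ (W (n₀ + m)).1 (idx (n₀ + m) t + 1) := by
      rcases ht.1.eq_or_lt with h2 | h2
      · rw [h2, hWk]; exact t.2.2
      · exact (ht.2.2 h2).le
    have h2 := hmesh m _ hs.1
    have h3 := hmesh m _ ht.1
    have h4 : (W (n₀ + m)).1 (idx (n₀ + m) t) ≤ (W (n₀ + m)).1 (idx (n₀ + m) s + 1) :=
      hmono _ _ _ (by omega) (by omega)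
    linarith [hs.2.1]

end Subdivision

/-! ### The limit arc, following, and local quasi-arcs -/

section Limit

variable {X : Type*} [MetricSpace X]

/-- A simple chain is the first of a sequence of simple chains at geometrically decreasing scales,
which converges to an arc. -/
theorem IsSimpleChain.exists_limit_arc [CompleteSpace X] {V : ℕ → X → Set X} {C c ρ δ : ℝ}
    (hC : 1 ≤ C) (hc : 0 < c) (hc1 : c ≤ 1) (hρ : 0 < ρ) (hδ : δ = c / (100 * C))
    (hV : ∀ n, IsSeparatedCover (V n) C c (ρ * δ ^ n)) {a b : X} (hab : a ≠ b) {k₀ : ℕ}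
    {x₀ : ℕ → X} (h₀ : IsSimpleChain (V 0) a b k₀ x₀) :
    ∃ (J : Arc X) (x : ℕ → ℕ → X) (idx : ℕ → unitInterval → ℕ),
      J.source = a ∧ J.target = b ∧ x 0 = x₀ ∧ (∀ n, Monotone (idx n)) ∧ (∀ t, idx 0 t ≤ k₀) ∧
      (∀ n s t, s ≤ t → idx n t ≤ idx n s + 1 →
        dist (x n (idx n s)) (x n (idx n t)) ≤ 2 * C * ρ * δ ^ n) ∧
      (∀ n t, dist (x n (idx n t)) (J.param t) ≤ 4 * C * ρ * δ ^ n) ∧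
      ∀ n s t, idx n s + 2 ≤ idx n t →
        c / 2 * ρ * δ ^ n < dist (J.param s) (J.param t) := by
  have hC0 : 0 < C := by linarith
  have hδ0 : 0 < δ := by rw [hδ]; positivity
  have hCδ : C * δ = c / 100 := by rw [hδ]; field_simp
  have hδ1 : δ ≤ 1 / 100 := by nlinarith
  have hpos : ∀ n, 0 < ρ * δ ^ n := fun n => by positivity
  have hCsucc : ∀ n, C * (ρ * δ ^ (n + 1)) = c / 100 * (ρ * δ ^ n) := fun n => by
    rw [← hCδ, pow_succ]; ring
  let S : ℕ → Type _ := fun n => {p : ℕ × (ℕ → X) // IsSimpleChain (V n) a b p.1 p.2}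
  have hrefine : ∀ n (p : S n), ∃ (q : S (n + 1)) (l : ℕ → ℕ), l 0 = 0 ∧ l q.1.1 = p.1.1 ∧
      (∀ j < q.1.1, l j ≤ l (j + 1) ∧ l (j + 1) ≤ l j + 1) ∧
      (∀ j ≤ q.1.1, ∃ v ∈ V n (p.1.2 (l j)), dist (q.1.2 j) v ≤ 2 * C * (ρ * δ ^ (n + 1))) ∧
      (4 * C * (ρ * δ ^ (n + 1)) < dist a b →
        ∀ i ≤ p.1.1, ∃ j < q.1.1, l j = i ∧ l (j + 1) = i) := by
    rintro n ⟨⟨k, x⟩, hx⟩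
    obtain ⟨k', x', l, hx', h⟩ := hx.exists_refinement hC (hpos (n + 1)) (hpos n)
      (by have := hCsucc n; have := mul_pos hc (hpos n); linarith) (hV n) (hV (n + 1))
    exact ⟨⟨⟨k', x'⟩, hx'⟩, l, h⟩
  choose next l' hl0' hlk' hl' hclose' hsplit' using hrefine
  let seq : ∀ n, S n := fun n => Nat.rec (⟨⟨k₀, x₀⟩, h₀⟩ : S 0) next n
  let k : ℕ → ℕ := fun n => (seq n).1.1
  let x : ℕ → ℕ → X := fun n => (seq n).1.2
  let l : ℕ → ℕ → ℕ := fun n => l' n (seq n)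
  have hx : ∀ n, IsSimpleChain (V n) a b (k n) (x n) := fun n => (seq n).2
  have hclose : ∀ n, ∀ j ≤ k (n + 1), ∃ v ∈ V n (x n (l n j)),
      dist (x (n + 1) j) v ≤ 2 * C * (ρ * δ ^ (n + 1)) := fun n => hclose' n (seq n)
  -- From level `n₀` on the scale is small against `dist a b`, so every member splits.
  obtain ⟨n₀, hn₀⟩ := exists_pow_lt_of_lt_one
    (show 0 < dist a b / (4 * C * ρ) by have := dist_pos.2 hab; positivity)
    (show δ < 1 by linarith)
  rw [lt_div_iff₀ (by positivity)] at hn₀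
  obtain ⟨idx, hmono, hi0, hi1, hik, hil, hig, hisep⟩ := exists_compatible_indices
    (k := k) (l := l) (n₀ := n₀) (fun n => hl0' n (seq n)) (fun n => hlk' n (seq n))
    (fun n => hl' n (seq n)) (fun n hn => hsplit' n (seq n) (by
      have h1 : δ ^ (n + 1) ≤ δ ^ n₀ := pow_le_pow_of_le_one hδ0.le (by linarith) (by omega)
      have h2 : δ ^ (n + 1) * (4 * C * ρ) ≤ δ ^ n₀ * (4 * C * ρ) := by gcongr
      linarith))
  have hstep : ∀ n, ∀ j < k n, dist (x n j) (x n (j + 1)) ≤ 2 * C * ρ * δ ^ n := fun n j hj => by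
    have := (hV n).dist_le_of_inter ((hx n).inter j hj)
    linarith
  have hnear : ∀ n t, ∃ v ∈ V n (x n (idx n t)),
      dist (x (n + 1) (idx (n + 1) t)) v ≤ 2 * C * (ρ * δ ^ (n + 1)) := fun n t => by
    rw [← hil n t]
    exact hclose n _ (hik _ t)
  have hgeom : ∀ t n, dist (x n (idx n t)) (x (n + 1) (idx (n + 1) t)) ≤ 2 * C * ρ * δ ^ n := by
    intro t n
    obtain ⟨v, hv, hd⟩ := hnear n t
    have h1 := mem_closedBall'.1 ((hV n).subset_closedBall _ hv)
    have h2 := hCsucc n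
    have h3 : c * (ρ * δ ^ n) ≤ 1 * (C * (ρ * δ ^ n)) := by
      rw [one_mul]
      have := hpos n
      gcongr
      linarith
    rw [dist_comm] at hd
    have := mul_pos hC0 (hpos n)
    linarith [dist_triangle (x n (idx n t)) v (x (n + 1) (idx (n + 1) t))]
  have hlim : ∀ t, ∃ y, Tendsto (fun n => x n (idx n t)) atTop (𝓝 y) := fun t =>
    cauchySeq_tendsto_of_complete
      (cauchySeq_of_le_geometric δ (2 * C * ρ) (by linarith) (hgeom t))
  choose f hf using hlim
  have hfd : ∀ n t, dist (x n (idx n t)) (f t) ≤ 4 * C * ρ * δ ^ n := fun n t => by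
    refine (dist_le_of_le_geometric_of_tendsto δ (2 * C * ρ) (by linarith) (hgeom t) (hf t) n).trans ?_
    rw [div_le_iff₀ (by linarith)]
    have : 0 < C * ρ * δ ^ n := by positivity
    nlinarith
  have hadj : ∀ n s t, s ≤ t → idx n t ≤ idx n s + 1 →
      dist (x n (idx n s)) (x n (idx n t)) ≤ 2 * C * ρ * δ ^ n := by
    intro n s t hst h
    have h1 := hmono n hst
    obtain h2 | h2 : idx n t = idx n s ∨ idx n t = idx n s + 1 := by omega
    · rw [h2, dist_self]; positivity
    · have := hik n t
      rw [h2]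
      exact hstep n _ (by omega)
  have hcont : Continuous f := by
    rw [Metric.continuous_iff]
    intro t ε hε
    obtain ⟨n, hn⟩ := exists_pow_lt_of_lt_one
      (show 0 < ε / (10 * C * ρ) by positivity) (show δ < 1 by linarith)
    rw [lt_div_iff₀ (by positivity)] at hn
    obtain ⟨g, hg, hgi⟩ := hig n
    refine ⟨g, hg, fun s hst => ?_⟩
    have h1 : dist (x n (idx n s)) (x n (idx n t)) ≤ 2 * C * ρ * δ ^ n := by
      rcases le_total s t with h | h
      · exact hadj n s t h (hgi s t hst)
      · rw [dist_comm]
        exact hadj n t s h (hgi t s (by rwa [dist_comm]))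
    have h2 := hfd n s
    have h3 := hfd n t
    rw [dist_comm] at h2
    linarith [dist_triangle4 (f s) (x n (idx n s)) (x n (idx n t)) (f t)]
  -- The points `u` and `v` of the disjoint level-`n` sets are at least `c * ρ * δ ^ n` apart. Each
  -- is within `(2 + 4) * C * ρ * δ ^ (n + 1)` of the limit point, and the choice of `δ` makes the
  -- total loss `12 / 100 * c * ρ * δ ^ n`.
  have hlower : ∀ n s t, idx n s + 2 ≤ idx n t → c / 2 * ρ * δ ^ n < dist (f s) (f t) := by
    intro n s t h
    obtain ⟨u, hu, hus⟩ := hnear n s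
    obtain ⟨v, hv, hvt⟩ := hnear n t
    have h1 := (hV n).le_dist _ _ ((hx n).disjoint _ _ h (hik n t)) u hu v hv
    have h2 := hfd (n + 1) s
    have h3 := hfd (n + 1) t
    have h4 := hCsucc n
    have h5 := mul_pos hc (hpos n)
    rw [dist_comm] at hus h3
    linarith [dist_triangle4 u (x (n + 1) (idx (n + 1) s)) (f s) v,
      dist_triangle4 (f s) (f t) (x (n + 1) (idx (n + 1) t)) v]
  refine ⟨⟨⟨f, hcont⟩, ?_⟩, x, idx, ?_, ?_, rfl, hmono, hik 0, hadj, hfd, hlower⟩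
  · refine Function.Injective.of_lt_imp_ne fun s t hst h => ?_
    obtain ⟨n, hn⟩ := hisep s t hst
    have := hlower n s t hn
    rw [show f s = f t from h, dist_self] at this
    have h2 := mul_pos hc (hpos n)
    linarith
  · refine tendsto_nhds_unique (hf 0) ?_
    simp only [hi0, (hx _).zero, tendsto_const_nhds]
  · refine tendsto_nhds_unique (hf 1) ?_
    simp only [hi1, (hx _).last, tendsto_const_nhds]

/-- The following map is `q` read through the two parametrizations; monotonicity sends the
parameters between `s` and `t` between `q s` and `q t`. -/
theorem Arc.follows_of_monotone {A J : Arc X} {ε : ℝ} {q : unitInterval → unitInterval}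
    (hq : Monotone q) (hq0 : q 0 = 0) (hq1 : q 1 = 1)
    (hqd : ∀ t, dist (J.param t) (A.param (q t)) < ε) : J.Follows A ε := by
  have hinv : ∀ t, Function.invFun J.param (J.param t) = t :=
    Function.leftInverse_invFun J.injective
  refine ⟨fun z => A.param (q (Function.invFun J.param z)), fun z _ => mem_range_self _, ?_, ?_, ?_⟩
  · simp only [Arc.source, hinv, hq0]
  · simp only [Arc.target, hinv, hq1]
  · rintro _ ⟨s, rfl⟩ _ ⟨t, rfl⟩
    simp only [hinv, Arc.subarc_param]
    rintro _ ⟨u, hu, rfl⟩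
    exact mem_thickening_iff.2 ⟨_, mem_image_of_mem _ (hq.image_uIcc_subset ⟨u, hu, rfl⟩), hqd u⟩

theorem Arc.isLocalQuasiArc_of_forall_le {J : Arc X} {ε lam : ℝ}
    (h : ∀ s t, s ≤ t → dist (J.param s) (J.param t) ≤ ε →
      diam (J.param '' Icc s t) ≤ lam * dist (J.param s) (J.param t)) :
    J.IsLocalQuasiArc ε lam := by
  rintro _ ⟨s, rfl⟩ _ ⟨t, rfl⟩ hst
  rw [Arc.subarc_param]
  rcases le_total s t with hle | hle
  · rw [uIcc_of_le hle]
    exact h s t hle hst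
  · rw [uIcc_of_ge hle, dist_comm]
    exact h t s hle (by rwa [dist_comm])

end Limit

end QuasiArc

/-! ### Choice of constants and conclusion -/

theorem theorem1p1 (L : ℝ) (hL : 1 ≤ L) (N : ℕ) :
    ∃ lam α : ℝ, 1 ≤ lam ∧ 0 < α ∧
      ∀ (X : Type*) [MetricSpace X] [CompleteSpace X],
        QuasiArc.IsLinearlyConnected X L → QuasiArc.IsDoubling X N →
        ∀ (A : QuasiArc.Arc X) (ε : ℝ), 0 < ε →
          ∃ J : QuasiArc.Arc X,
            J.source = A.source ∧ J.target = A.target ∧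
            J.Follows A ε ∧ J.IsLocalQuasiArc (α * ε) lam := by
  obtain ⟨C, c, hC, hc, hc1, hcover⟩ := QuasiArc.exists_isSeparatedCover hL N
  have hC0 : 0 < C := by linarith
  obtain ⟨δ, hδ⟩ : ∃ δ, δ = c / (100 * C) := ⟨_, rfl⟩
  have hδ0 : 0 < δ := by rw [hδ]; positivity
  have hδ1 : δ < 1 := by
    rw [hδ, div_lt_one (by positivity)]
    linarith
  -- With `ε = 6 * C * ρ` the second constant gives `α * ε = c / 4 * ρ`, below the level-zero
  -- separation `c / 2 * ρ`. The first is the diameter bound `12 * C * ρ * δ ^ n` divided by the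
  -- lower bound `c / 2 * ρ * δ ^ (n + 1)` for the distance.
  refine ⟨24 * C / (c * δ), c / (24 * C), ?_, by positivity, ?_⟩
  · rw [one_le_div (by positivity)]
    nlinarith
  intro X _ _ hX hN A ε hε
  obtain ⟨ρ, hρ⟩ : ∃ ρ, ρ = ε / (6 * C) := ⟨_, rfl⟩
  have hρ0 : 0 < ρ := by rw [hρ]; positivity
  have hCρ : 6 * (C * ρ) = ε := by rw [hρ]; field_simp
  have hle : ρ ≤ C * ρ := le_mul_of_one_le_left hρ0.le hC
  choose V hV using fun n : ℕ => hcover X hX hN (ρ * δ ^ n) (by positivity)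
  obtain ⟨k, x₀, τ, hx₀, hτ0, hτk, hτ, hτA⟩ := QuasiArc.exists_labelled_simpleChain
    (U := fun t => {A.param t}) (by positivity) (hV 0).mem_of_dist_le (Set.mem_singleton (A.param 0))
    (QuasiArc.exists_walk_of_path A.param (r := ρ * δ ^ 0) (by positivity))
  have hab : A.param 0 ≠ A.param 1 := A.injective.ne zero_ne_one
  obtain ⟨J, x, idx, hJ0, hJ1, rfl, hmono, hik, hadj, hd, hlower⟩ :=
    hx₀.exists_limit_arc hC hc hc1 hρ0 hδ hV hab
  have hτmono : ∀ i j, i ≤ j → j ≤ k → τ i ≤ τ j := by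
    intro i j hij
    induction j, hij using Nat.le_induction with
    | base => intro _; exact le_rfl
    | succ j _ ih => intro hj; exact (ih (by omega)).trans (hτ j (by omega))
  refine ⟨J, hJ0, hJ1, ?_, ?_⟩
  -- The values at `0` and `1` are prescribed so that endpoints go to endpoints; being extreme, they
  -- preserve monotonicity. Elsewhere the error is at most `4 * C * ρ < ε`.
  · refine QuasiArc.Arc.follows_of_monotone
      (q := fun t => if t = 0 then 0 else if t = 1 then 1 else τ (idx 0 t)) ?_ (by simp) (by simp) ?_
    · intro s t hst
      by_cases hs : s = 0
      · simp [hs]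
      by_cases ht : t = 1
      · simpa [ht] using unitInterval.le_one'
      have hs1 : s ≠ 1 := fun h => ht (le_antisymm unitInterval.le_one' (h ▸ hst))
      have ht0 : t ≠ 0 := fun h => hs (le_antisymm (h ▸ hst) unitInterval.nonneg')
      simpa only [if_neg hs, if_neg ht, if_neg hs1, if_neg ht0] using
        hτmono _ _ (hmono 0 hst) (hik t)
    · intro t
      split_ifs with h1 h2
      · subst h1
        rwa [show J.param 0 = A.param 0 from hJ0, dist_self]
      · subst h2
        rwa [show J.param 1 = A.param 1 from hJ1, dist_self]
      · have h3 := hd 0 t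
        rw [hτA _ (hik t), dist_comm, pow_zero] at h3
        have := mul_pos hC0 hρ0
        linarith
  · refine QuasiArc.Arc.isLocalQuasiArc_of_forall_le fun s t hst hle => ?_
    rcases hst.eq_or_lt with rfl | hlt
    · simp
    have hdpos : 0 < dist (J.param s) (J.param t) := dist_pos.2 (J.injective.ne hlt.ne)
    set d := dist (J.param s) (J.param t) with hdef
    have hαε : c / (24 * C) * ε = c / 4 * ρ := by
      rw [← hCρ]; field_simp; ring
    rw [hαε] at hle
    have hcρ : 0 < c / 2 * ρ := by positivity
    -- The level with `δ ^ (n + 1) * (c / 2 * ρ) < d ≤ δ ^ n * (c / 2 * ρ)`: the upper bound forces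
    -- equal or adjacent indices, the lower one converts the diameter bound into a multiple of `d`.
    obtain ⟨n, hn1, hn2⟩ := exists_nat_pow_near_of_lt_one (x := d / (c / 2 * ρ)) (y := δ)
      (by positivity) (by rw [div_le_one hcρ]; linarith) hδ0 hδ1
    rw [lt_div_iff₀ hcρ] at hn1
    rw [div_le_iff₀ hcρ] at hn2
    have hidx : idx n t ≤ idx n s + 1 := by
      by_contra! h
      have := hlower n s t h
      rw [← hdef] at this
      linarith
    have hcenter : ∀ u ∈ Set.Icc s t,
        dist (J.param u) (x n (idx n s)) ≤ 6 * C * ρ * δ ^ n := by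
      intro u hu
      have h1 := hadj n s u hu.1 ((hmono n hu.2).trans hidx)
      have h2 := hd n u
      rw [dist_comm] at h1 h2
      linarith [dist_triangle (J.param u) (x n (idx n u)) (x n (idx n s))]
    have hdiam : Metric.diam (J.param '' Set.Icc s t) ≤ 12 * C * ρ * δ ^ n := by
      refine Metric.diam_le_of_forall_dist_le (by positivity) ?_
      rintro _ ⟨u, hu, rfl⟩ _ ⟨v, hv, rfl⟩
      linarith [dist_triangle_right (J.param u) (J.param v) (x n (idx n s)), hcenter u hu,
        hcenter v hv]
    refine hdiam.trans ?_
    rw [div_mul_eq_mul_div, le_div_iff₀ (by positivity)]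
    calc 12 * C * ρ * δ ^ n * (c * δ) = 24 * C * (δ ^ (n + 1) * (c / 2 * ρ)) := by
          rw [pow_succ]; ring
      _ ≤ 24 * C * d := by gcongr
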